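/- All games are short (finite) partizan game forms $G=\{G^{L}\mid G^{R}\}$ under the misère play convention (a player who cannot move on their turn wins), with disjunctive sum $G+H=\{G^L+H,\,G+H^L\mid G^R+H,\,G+H^R\}$. The outcome $\mathrm{o}(G)$ is $\mathscr{L}$, $\mathscr{R}$, $\mathscr{N}$ or $\mathscr{P}$ according to whether Left, Right, the first player, or the second player can force a win; outcomes are partially ordered by $\mathscr{L}>\mathscr{N}>\mathscr{R}$ and $\mathscr{L}>\mathscr{P}>\mathscr{R}$, with $\mathscr{N}$ and $\mathscr{P}$ incomparable. A subposition of $G$ is a form reached from $G$ by any (possibly empty, not necessarily alternating) sequence of moves. A Left end is a form without Left options, and a Right end is a form without Right options. A Left end $X$ is blocked if every Right option $X^R$ of $X$ either is a blocked Left end or has a Left option $X^{RL}$ that is a blocked Left end; blocked Right ends are defined symmetrically. A form is blocking if each of its subpositions that is a Left end is a blocked Left end, and each that is a Right end is a blocked Right end. Let $\mathcal{B}$ be the set of all blocking forms. For a set of forms $\mathcal{A}$, write $G\ge_{\mathcal{A}}H$ if $\mathrm{o}(G+X)\ge \mathrm{o}(H+X)$ for all $X\in\mathcal{A}$, and $G\equiv_{\mathcal{A}}H$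 if $G\ge_{\mathcal{A}}H$ and $H\ge_{\mathcal{A}}G$. A form is $\mathscr{P}$-free if none of its subpositions has outcome $\mathscr{P}$. Let $\mathrm{PF}(\mathcal{B})$ be the set of $\mathscr{P}$-free forms in $\mathcal{B}$, and let $\mathrm{PF}_{\mathcal{B}}(\mathcal{B})$ be the set of those $G\in\mathcal{B}$ for which there is some $G'\in\mathrm{PF}(\mathcal{B})$ with $G\equiv_{\mathcal{B}}G'$. **Theorem.** The set $\mathrm{PF}(\mathcal{B})$ is closed under addition: if $G,H\in\mathrm{PF}(\mathcal{B})$, then $G+H\in\mathrm{PF}(\mathcal{B})$. Likewise $\mathrm{PF}_{\mathcal{B}}(\mathcal{B})$ is closed under addition: if $G,H\in\mathrm{PF}_{\mathcal{B}}(\mathcal{B})$, then $G+H\in\mathrm{PF}_{\mathcal{B}}(\mathcal{B})$. -/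

import Mathlib

/-- Short partizan game forms `{G^L | G^R}`: finite trees with finitely many Left options `L i` and
finitely many Right options `R j`. The order and the multiplicity in which the options are listed
are immaterial: every notion below depends only on the sets of options, hence it is invariant under
isomorphism of forms. -/
inductive GameForm : Type
  | mk (m n : ℕ) (L : Fin m → GameForm) (R : Fin n → GameForm) : GameForm

namespace GameForm

/-- `G.IsLeftOption G'`: Left can move from `G` to `G'`. -/
def IsLeftOption : GameForm → GameForm → Prop
  | mk _ _ L _, G' => ∃ i, L i = G'

/-- `G.IsRightOption G'`: Right can move from `G` to `G'`. -/
def IsRightOption : GameForm → GameForm → Prop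
  | mk _ _ _ R, G' => ∃ j, R j = G'

/-- `G.IsOption G'`: one of the two players can move from `G` to `G'`. -/
def IsOption (G G' : GameForm) : Prop :=
  G.IsLeftOption G' ∨ G.IsRightOption G'

/-- `G.IsSubposition G'`: the form `G'` can be reached from `G` by a possibly empty and not
necessarily alternating sequence of moves. -/
def IsSubposition : GameForm → GameForm → Prop :=
  Relation.ReflTransGen IsOption

/-- A Left end is a form in which Left has no options. -/
def IsLeftEnd (G : GameForm) : Prop :=
  ∀ G', ¬ G.IsLeftOption G'

/-- A Right end is a form in which Right has no options. -/
def IsRightEnd (G : GameForm) : Prop :=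
  ∀ G', ¬ G.IsRightOption G'

/-- The sum of `{L | R}` with a form `H`, given the functions `X ↦ L i + X` and `X ↦ R j + X`. -/
def addAux {m n : ℕ} (addL : Fin m → GameForm → GameForm) (addR : Fin n → GameForm → GameForm) :
    GameForm → GameForm
  | mk m' n' L' R' =>
    mk (m + m') (n + n')
      (Fin.append (fun i => addL i (mk m' n' L' R')) (fun i => addAux addL addR (L' i)))
      (Fin.append (fun j => addR j (mk m' n' L' R')) (fun j => addAux addL addR (R' j)))

/-- The disjunctive sum: `G + H = {G^L + H, G + H^L | G^R + H, G + H^R}`. -/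
def add : GameForm → GameForm → GameForm
  | mk _ _ L R => addAux (fun i => add (L i)) (fun j => add (R j))

instance : Add GameForm := ⟨add⟩

mutual

/-- Left wins playing first under the misère play convention: either she cannot move, or she has a
move after which Right does not win playing first. -/
def LeftWinsFirst : GameForm → Prop
  | mk m _ L _ => m = 0 ∨ ∃ i, ¬ RightWinsFirst (L i)

/-- Right wins playing first under the misère play convention. -/
def RightWinsFirst : GameForm → Prop
  | mk _ n _ R => n = 0 ∨ ∃ j, ¬ LeftWinsFirst (R j)

end

/-- The four outcome classes: `L` (Left wins whoever starts), `N` (the first player wins),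
`P` (the second player wins), `R` (Right wins whoever starts). -/
inductive Outcome : Type
  | L | N | P | R

/-- The partial order of outcomes: `R` is least, `L` is greatest, and `N` and `P` are
incomparable. -/
instance : PartialOrder Outcome where
  le a b := a = b ∨ a = .R ∨ b = .L
  le_refl _ := Or.inl rfl
  le_trans a b c := by cases a <;> cases b <;> cases c <;> simp
  le_antisymm a b := by cases a <;> cases b <;> simp

open Classical in
/-- The misère outcome of a form. -/
noncomputable def outcome (G : GameForm) : Outcome :=
  if G.LeftWinsFirst then
    if G.RightWinsFirst then .N else .L
  else
    if G.RightWinsFirst then .R else .P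

/-- `GeMod A G H` is the relation `G ≥_A H`: `o(G + X) ≥ o(H + X)` for all `X ∈ A`. -/
def GeMod (A : Set GameForm) (G H : GameForm) : Prop :=
  ∀ X ∈ A, (H + X).outcome ≤ (G + X).outcome

/-- `EquivMod A G H` is the relation `G ≡_A H`. -/
def EquivMod (A : Set GameForm) (G H : GameForm) : Prop :=
  GeMod A G H ∧ GeMod A H G

/-- A form is (strictly) P-free if no subposition of it has outcome `P`. -/
def IsPFree (G : GameForm) : Prop :=
  ∀ G', G.IsSubposition G' → G'.outcome ≠ .P

/-- The set of strictly P-free elements of `A`. -/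
def pFree (A : Set GameForm) : Set GameForm :=
  {G | G ∈ A ∧ G.IsPFree}

/-- `G` is P-free modulo `A` if `G ≡_A H` for some strictly P-free `H ∈ A`. -/
def IsPFreeMod (A : Set GameForm) (G : GameForm) : Prop :=
  ∃ H ∈ A, H.IsPFree ∧ EquivMod A G H

/-- The set of elements of `A` that are P-free modulo `S`. -/
def pFreeMod (A S : Set GameForm) : Set GameForm :=
  {G | G ∈ A ∧ IsPFreeMod S G}

mutual

/-- `X` is a blocked Left end: it is a Left end, and every Right option `X^R` either is a blocked
Left end or has a Left option `X^{RL}` that is a blocked Left end. -/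
def IsBlockedLeftEnd : GameForm → Prop
  | mk m _ _ R => m = 0 ∧ ∀ j, IsBlockedLeftEnd (R j) ∨ HasBlockedLeftResponse (R j)

/-- Some Left option of the form is a blocked Left end. -/
def HasBlockedLeftResponse : GameForm → Prop
  | mk _ _ L _ => ∃ i, IsBlockedLeftEnd (L i)

end

mutual

/-- `X` is a blocked Right end: it is a Right end, and every Left option `X^L` either is a blocked
Right end or has a Right option `X^{LR}` that is a blocked Right end. -/
def IsBlockedRightEnd : GameForm → Prop
  | mk _ n L _ => n = 0 ∧ ∀ i, IsBlockedRightEnd (L i) ∨ HasBlockedRightResponse (L i)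

/-- Some Right option of the form is a blocked Right end. -/
def HasBlockedRightResponse : GameForm → Prop
  | mk _ _ _ R => ∃ j, IsBlockedRightEnd (R j)

end

/-- A form is blocking if each of its subpositions that is an end is blocked. -/
def IsBlocking (G : GameForm) : Prop :=
  ∀ G', G.IsSubposition G' →
    (G'.IsLeftEnd → G'.IsBlockedLeftEnd) ∧ (G'.IsRightEnd → G'.IsBlockedRightEnd)

/-- The blocking universe: the set of all blocking forms. -/
def blockingUniverse : Set GameForm :=
  {G | G.IsBlocking}

end GameForm

namespace GameForm

/-! ### Options, ends and sums -/

-- Misère play is replaced by integer scores: the form without moves scores 0, a Left move subtracts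
-- one and a Right move adds one. The stops `leftStop` and `rightStop` are the resulting values with
-- Left or Right to start, with a special rule when neither player gains by moving. For a `P`-free
-- blocking form their signs give the outcome (`winsFirst_iff_stops`). Blocking makes the stops of
-- Left ends nonnegative and those of Right ends nonpositive; `P`-freeness excludes forms where
-- Left's best value is negative and Right's is positive.
--
-- Stops also control sums. Left moving first wins `G + H` if `0 ≤ leftStop G + rightStop H`
-- (`left_wins_add`), and Right moving first wins if the same integer is at most 0
-- (`right_wins_add`). One of the two always holds, so the sum does not have outcome `P`.
-- Subpositions of a sum are sums of subpositions, so this gives `P`-freeness; blocking survives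
-- sums because responses can be made in the component just played. The statement modulo equivalence
-- follows by replacing each summand with a `P`-free representative.

theorem isOption_wellFounded : WellFounded (fun G' G : GameForm => G.IsOption G') := by
  refine ⟨fun G => ?_⟩
  induction G with
  | mk m n L R ihL ihR =>
    refine ⟨_, fun G' h => ?_⟩
    rcases h with ⟨i, rfl⟩ | ⟨j, rfl⟩
    · exact ihL i
    · exact ihR j

/-- Induction over all proper subpositions. -/
theorem subposition_induction {p : GameForm → Prop}
    (h : ∀ G, (∀ G', Relation.TransGen (fun G' G : GameForm => G.IsOption G') G' G → p G') → p G)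
    (G : GameForm) : p G :=
  isOption_wellFounded.transGen.induction G h

/-- Induction over options. -/
theorem option_induction {p : GameForm → Prop}
    (h : ∀ G, (∀ G', G.IsLeftOption G' → p G') → (∀ G', G.IsRightOption G' → p G') → p G)
    (G : GameForm) : p G :=
  isOption_wellFounded.induction G fun G ih =>
    h G (fun G' h' => ih G' (Or.inl h')) (fun G' h' => ih G' (Or.inr h'))

theorem mk_isLeftEnd {m n : ℕ} {L : Fin m → GameForm} {R : Fin n → GameForm} :
    (mk m n L R).IsLeftEnd ↔ m = 0 := by
  constructor
  · intro h
    by_contra hm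
    exact h _ ⟨⟨0, Nat.pos_of_ne_zero hm⟩, rfl⟩
  · rintro rfl G' ⟨i, _⟩
    exact i.elim0

theorem mk_isRightEnd {m n : ℕ} {L : Fin m → GameForm} {R : Fin n → GameForm} :
    (mk m n L R).IsRightEnd ↔ n = 0 := by
  constructor
  · intro h
    by_contra hm
    exact h _ ⟨⟨0, Nat.pos_of_ne_zero hm⟩, rfl⟩
  · rintro rfl G' ⟨i, _⟩
    exact i.elim0

theorem mk_add_mk {m n m' n' : ℕ} (L : Fin m → GameForm) (R : Fin n → GameForm)
    (L' : Fin m' → GameForm) (R' : Fin n' → GameForm) :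
    mk m n L R + mk m' n' L' R' = mk (m + m') (n + n')
      (Fin.append (fun i => L i + mk m' n' L' R') (fun i => mk m n L R + L' i))
      (Fin.append (fun j => R j + mk m' n' L' R') (fun j => mk m n L R + R' j)) := by
  change add (mk m n L R) (mk m' n' L' R') = _
  simp only [add, addAux]
  rfl

theorem isLeftOption_add {G H K : GameForm} : (G + H).IsLeftOption K ↔
    (∃ G', G.IsLeftOption G' ∧ K = G' + H) ∨ (∃ H', H.IsLeftOption H' ∧ K = G + H') := by
  obtain ⟨m, n, L, R⟩ := G
  obtain ⟨m', n', L', R'⟩ := H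
  rw [mk_add_mk]
  constructor
  · rintro ⟨i, rfl⟩
    induction i using Fin.addCases with
    | left i => exact Or.inl ⟨L i, ⟨i, rfl⟩, by simp⟩
    | right i => exact Or.inr ⟨L' i, ⟨i, rfl⟩, by simp⟩
  · rintro (⟨_, ⟨i, rfl⟩, rfl⟩ | ⟨_, ⟨i, rfl⟩, rfl⟩)
    · exact ⟨Fin.castAdd _ i, by simp⟩
    · exact ⟨Fin.natAdd _ i, by simp⟩

theorem isRightOption_add {G H K : GameForm} : (G + H).IsRightOption K ↔
    (∃ G', G.IsRightOption G' ∧ K = G' + H) ∨ (∃ H', H.IsRightOption H' ∧ K = G + H') := by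
  obtain ⟨m, n, L, R⟩ := G
  obtain ⟨m', n', L', R'⟩ := H
  rw [mk_add_mk]
  constructor
  · rintro ⟨i, rfl⟩
    induction i using Fin.addCases with
    | left i => exact Or.inl ⟨R i, ⟨i, rfl⟩, by simp⟩
    | right i => exact Or.inr ⟨R' i, ⟨i, rfl⟩, by simp⟩
  · rintro (⟨_, ⟨i, rfl⟩, rfl⟩ | ⟨_, ⟨i, rfl⟩, rfl⟩)
    · exact ⟨Fin.castAdd _ i, by simp⟩
    · exact ⟨Fin.natAdd _ i, by simp⟩

theorem isLeftEnd_add {G H : GameForm} : (G + H).IsLeftEnd ↔ G.IsLeftEnd ∧ H.IsLeftEnd := by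
  obtain ⟨m, n, L, R⟩ := G
  obtain ⟨m', n', L', R'⟩ := H
  rw [mk_add_mk]
  simp only [mk_isLeftEnd]
  omega

theorem isRightEnd_add {G H : GameForm} : (G + H).IsRightEnd ↔ G.IsRightEnd ∧ H.IsRightEnd := by
  obtain ⟨m, n, L, R⟩ := G
  obtain ⟨m', n', L', R'⟩ := H
  rw [mk_add_mk]
  simp only [mk_isRightEnd]
  omega

theorem IsSubposition.exists_of_add {G H K : GameForm} (h : (G + H).IsSubposition K) :
    ∃ G' H', G.IsSubposition G' ∧ H.IsSubposition H' ∧ K = G' + H' := by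
  induction h with
  | refl => exact ⟨G, H, .refl, .refl, rfl⟩
  | tail _ hstep ih =>
    obtain ⟨G', H', hG, hH, rfl⟩ := ih
    rcases hstep with h | h
    · rcases isLeftOption_add.1 h with ⟨X, hX, rfl⟩ | ⟨X, hX, rfl⟩
      · exact ⟨X, H', hG.tail (Or.inl hX), hH, rfl⟩
      · exact ⟨G', X, hG, hH.tail (Or.inl hX), rfl⟩
    · rcases isRightOption_add.1 h with ⟨X, hX, rfl⟩ | ⟨X, hX, rfl⟩
      · exact ⟨X, H', hG.tail (Or.inr hX), hH, rfl⟩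
      · exact ⟨G', X, hG, hH.tail (Or.inr hX), rfl⟩

/-! ### Outcomes -/

theorem leftWinsFirst_iff {G : GameForm} :
    G.LeftWinsFirst ↔ G.IsLeftEnd ∨ ∃ G', G.IsLeftOption G' ∧ ¬ G'.RightWinsFirst := by
  obtain ⟨m, n, L, R⟩ := G
  rw [mk_isLeftEnd, LeftWinsFirst]
  simp [IsLeftOption]

theorem rightWinsFirst_iff {G : GameForm} :
    G.RightWinsFirst ↔ G.IsRightEnd ∨ ∃ G', G.IsRightOption G' ∧ ¬ G'.LeftWinsFirst := by
  obtain ⟨m, n, L, R⟩ := G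
  rw [mk_isRightEnd, RightWinsFirst]
  simp [IsRightOption]

theorem outcome_ne_P {G : GameForm} : G.outcome ≠ .P ↔ G.LeftWinsFirst ∨ G.RightWinsFirst := by
  unfold outcome
  by_cases h1 : G.LeftWinsFirst <;> by_cases h2 : G.RightWinsFirst <;> simp [h1, h2]

/-- Forms related by a bisimulation have the same outcome. -/
theorem outcome_eq_of_bisimulation {S : GameForm → GameForm → Prop}
    (hL : ∀ G H, S G H → ∀ G', G.IsLeftOption G' → ∃ H', H.IsLeftOption H' ∧ S G' H')
    (hL' : ∀ G H, S G H → ∀ H', H.IsLeftOption H' → ∃ G', G.IsLeftOption G' ∧ S G' H')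
    (hR : ∀ G H, S G H → ∀ G', G.IsRightOption G' → ∃ H', H.IsRightOption H' ∧ S G' H')
    (hR' : ∀ G H, S G H → ∀ H', H.IsRightOption H' → ∃ G', G.IsRightOption G' ∧ S G' H')
    {G H : GameForm} (h : S G H) : G.outcome = H.outcome := by
  have key : ∀ G H, S G H → (G.LeftWinsFirst ↔ H.LeftWinsFirst) ∧
      (G.RightWinsFirst ↔ H.RightWinsFirst) := by
    intro G
    induction G using option_induction with
    | h G ihL ihR =>
      intro H h
      rw [leftWinsFirst_iff, leftWinsFirst_iff, rightWinsFirst_iff, rightWinsFirst_iff]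
      refine ⟨or_congr ⟨fun e H' h' => ?_, fun e G' h' => ?_⟩ ⟨?_, ?_⟩,
        or_congr ⟨fun e H' h' => ?_, fun e G' h' => ?_⟩ ⟨?_, ?_⟩⟩
      · obtain ⟨G', hG, -⟩ := hL' G H h H' h'
        exact e G' hG
      · obtain ⟨H', hH, -⟩ := hL G H h G' h'
        exact e H' hH
      · rintro ⟨G', hG, hw⟩
        obtain ⟨H', hH, hs⟩ := hL G H h G' hG
        exact ⟨H', hH, fun hc => hw ((ihL G' hG H' hs).2.2 hc)⟩
      · rintro ⟨H', hH, hw⟩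
        obtain ⟨G', hG, hs⟩ := hL' G H h H' hH
        exact ⟨G', hG, fun hc => hw ((ihL G' hG H' hs).2.1 hc)⟩
      · obtain ⟨G', hG, -⟩ := hR' G H h H' h'
        exact e G' hG
      · obtain ⟨H', hH, -⟩ := hR G H h G' h'
        exact e H' hH
      · rintro ⟨G', hG, hw⟩
        obtain ⟨H', hH, hs⟩ := hR G H h G' hG
        exact ⟨H', hH, fun hc => hw ((ihR G' hG H' hs).1.2 hc)⟩
      · rintro ⟨H', hH, hw⟩
        obtain ⟨G', hG, hs⟩ := hR' G H h H' hH
        exact ⟨G', hG, fun hc => hw ((ihR G' hG H' hs).1.1 hc)⟩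
  obtain ⟨h1, h2⟩ := key G H h
  unfold outcome
  by_cases hl : H.LeftWinsFirst <;> by_cases hr : H.RightWinsFirst <;> simp [h1, h2, hl, hr]

/-- The pairs of this shape form a bisimulation: a move in one summand is matched by the same move
on the other side. Comparing outcomes only makes the listing of options irrelevant. -/
theorem outcome_add_assoc (G H K : GameForm) :
    ((G + H) + K).outcome = (G + (H + K)).outcome := by
  refine outcome_eq_of_bisimulation
    (S := fun X Y => ∃ G H K, X = (G + H) + K ∧ Y = G + (H + K)) ?_ ?_ ?_ ?_ ⟨G, H, K, rfl, rfl⟩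
  all_goals
    rintro _ _ ⟨G, H, K, rfl, rfl⟩ X hX
    simp only [isLeftOption_add, isRightOption_add] at hX ⊢
    aesop

theorem outcome_add_left_comm (G H K : GameForm) :
    (G + (H + K)).outcome = (H + (G + K)).outcome := by
  refine outcome_eq_of_bisimulation
    (S := fun X Y => ∃ G H K, X = G + (H + K) ∧ Y = H + (G + K)) ?_ ?_ ?_ ?_ ⟨G, H, K, rfl, rfl⟩
  all_goals
    rintro _ _ ⟨G, H, K, rfl, rfl⟩ X hX
    simp only [isLeftOption_add, isRightOption_add] at hX ⊢
    aesop

theorem equivMod_iff {A : Set GameForm} {G H : GameForm} :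
    EquivMod A G H ↔ ∀ X ∈ A, (G + X).outcome = (H + X).outcome :=
  ⟨fun h X hX => le_antisymm (h.2 X hX) (h.1 X hX),
    fun h => ⟨fun X hX => (h X hX).ge, fun X hX => (h X hX).le⟩⟩

/-- Equivalence modulo an additively closed set is compatible with sums of its elements. -/
theorem EquivMod.add {A : Set GameForm} (hA : ∀ X ∈ A, ∀ Y ∈ A, X + Y ∈ A) {G G' H H' : GameForm}
    (hG : EquivMod A G G') (hH : EquivMod A H H') (hHA : H ∈ A) (hGA : G' ∈ A) :
    EquivMod A (G + H) (G' + H') := by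
  rw [equivMod_iff] at *
  intro X hX
  -- One summand is exchanged at a time, the rest of the sum serving as the test form: first `H +
  -- X`, then `G' + X`.
  rw [outcome_add_assoc, hG _ (hA _ hHA _ hX), outcome_add_left_comm, hH _ (hA _ hGA _ hX),
    outcome_add_left_comm, outcome_add_assoc]

/-! ### Blocked ends -/

theorem isBlockedLeftEnd_iff {X : GameForm} : X.IsBlockedLeftEnd ↔ X.IsLeftEnd ∧
    ∀ Y, X.IsRightOption Y → Y.IsBlockedLeftEnd ∨ ∃ Z, Y.IsLeftOption Z ∧ Z.IsBlockedLeftEnd := by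
  have aux : ∀ Y : GameForm,
      Y.HasBlockedLeftResponse ↔ ∃ Z, Y.IsLeftOption Z ∧ Z.IsBlockedLeftEnd := by
    rintro ⟨m, n, L, R⟩
    simp [HasBlockedLeftResponse, IsLeftOption]
  obtain ⟨m, n, L, R⟩ := X
  rw [mk_isLeftEnd, IsBlockedLeftEnd]
  simp [IsRightOption, aux]

theorem isBlockedRightEnd_iff {X : GameForm} : X.IsBlockedRightEnd ↔ X.IsRightEnd ∧
    ∀ Y, X.IsLeftOption Y → Y.IsBlockedRightEnd ∨ ∃ Z, Y.IsRightOption Z ∧ Z.IsBlockedRightEnd := by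
  have aux : ∀ Y : GameForm,
      Y.HasBlockedRightResponse ↔ ∃ Z, Y.IsRightOption Z ∧ Z.IsBlockedRightEnd := by
    rintro ⟨m, n, L, R⟩
    simp [HasBlockedRightResponse, IsRightOption]
  obtain ⟨m, n, L, R⟩ := X
  rw [mk_isRightEnd, IsBlockedRightEnd]
  simp [IsLeftOption, aux]

/-- A Right move in one component is answered, if necessary, in that component. The answer lies two
moves down, hence the induction over all proper subpositions. -/
theorem IsBlockedLeftEnd.add {X Y : GameForm} (hX : X.IsBlockedLeftEnd)
    (hY : Y.IsBlockedLeftEnd) : (X + Y).IsBlockedLeftEnd := by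
  induction X using subposition_induction generalizing Y with
  | h X ihX =>
  induction Y using subposition_induction with
  | h Y ihY =>
    have hX' := isBlockedLeftEnd_iff.1 hX
    have hY' := isBlockedLeftEnd_iff.1 hY
    refine isBlockedLeftEnd_iff.2 ⟨isLeftEnd_add.2 ⟨hX'.1, hY'.1⟩, fun K hXY => ?_⟩
    rcases isRightOption_add.1 hXY with ⟨K, hK, rfl⟩ | ⟨K, hK, rfl⟩
    · rcases hX'.2 K hK with hb | ⟨Z, hZ, hb⟩
      · exact Or.inl (ihX K (.single (Or.inr hK)) hb hY)
      · exact Or.inr ⟨Z + Y, isLeftOption_add.2 (Or.inl ⟨Z, hZ, rfl⟩),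
          ihX Z (.tail (.single (Or.inl hZ)) (Or.inr hK)) hb hY⟩
    · rcases hY'.2 K hK with hb | ⟨Z, hZ, hb⟩
      · exact Or.inl (ihY K (.single (Or.inr hK)) hb)
      · exact Or.inr ⟨X + Z, isLeftOption_add.2 (Or.inr ⟨Z, hZ, rfl⟩),
          ihY Z (.tail (.single (Or.inl hZ)) (Or.inr hK)) hb⟩

theorem IsBlockedRightEnd.add {X Y : GameForm} (hX : X.IsBlockedRightEnd)
    (hY : Y.IsBlockedRightEnd) : (X + Y).IsBlockedRightEnd := by
  induction X using subposition_induction generalizing Y with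
  | h X ihX =>
  induction Y using subposition_induction with
  | h Y ihY =>
    have hX' := isBlockedRightEnd_iff.1 hX
    have hY' := isBlockedRightEnd_iff.1 hY
    refine isBlockedRightEnd_iff.2 ⟨isRightEnd_add.2 ⟨hX'.1, hY'.1⟩, fun K hXY => ?_⟩
    rcases isLeftOption_add.1 hXY with ⟨K, hK, rfl⟩ | ⟨K, hK, rfl⟩
    · rcases hX'.2 K hK with hb | ⟨Z, hZ, hb⟩
      · exact Or.inl (ihX K (.single (Or.inl hK)) hb hY)
      · exact Or.inr ⟨Z + Y, isRightOption_add.2 (Or.inl ⟨Z, hZ, rfl⟩),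
          ihX Z (.tail (.single (Or.inr hZ)) (Or.inl hK)) hb hY⟩
    · rcases hY'.2 K hK with hb | ⟨Z, hZ, hb⟩
      · exact Or.inl (ihY K (.single (Or.inl hK)) hb)
      · exact Or.inr ⟨X + Z, isRightOption_add.2 (Or.inr ⟨Z, hZ, rfl⟩),
          ihY Z (.tail (.single (Or.inr hZ)) (Or.inl hK)) hb⟩

theorem add_mem_blockingUniverse (G : GameForm) (hG : G ∈ blockingUniverse) (H : GameForm)
    (hH : H ∈ blockingUniverse) : G + H ∈ blockingUniverse := by
  intro K hK
  obtain ⟨G', H', hG', hH', rfl⟩ := hK.exists_of_add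
  refine ⟨fun h => ?_, fun h => ?_⟩
  · exact ((hG G' hG').1 (isLeftEnd_add.1 h).1).add ((hH H' hH').1 (isLeftEnd_add.1 h).2)
  · exact ((hG G' hG').2 (isRightEnd_add.1 h).1).add ((hH H' hH').2 (isRightEnd_add.1 h).2)

theorem mem_pFree_of_isSubposition {G G' : GameForm} (hG : G ∈ pFree blockingUniverse)
    (h : G.IsSubposition G') : G' ∈ pFree blockingUniverse :=
  ⟨fun _ hK => hG.1 _ (h.trans hK), fun _ hK => hG.2 _ (h.trans hK)⟩

theorem IsLeftOption.mem_pFree {G G' : GameForm} (h : G.IsLeftOption G')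
    (hG : G ∈ pFree blockingUniverse) : G' ∈ pFree blockingUniverse :=
  mem_pFree_of_isSubposition hG (.single (Or.inl h))

theorem IsRightOption.mem_pFree {G G' : GameForm} (h : G.IsRightOption G')
    (hG : G ∈ pFree blockingUniverse) : G' ∈ pFree blockingUniverse :=
  mem_pFree_of_isSubposition hG (.single (Or.inr h))

/-! ### Stops -/

/-- The Left and the Right stop of a form, in which every move costs the player who makes it one
unit. If neither player gains by moving, both stops are equal to the stop that is farther from
zero. -/
noncomputable def stops : GameForm → ℤ × ℤ
  | mk m n L R =>
    -- Ends are treated apart, so the default value of an empty `⨆` or `⨅` never enters.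
    if m = 0 then
      if n = 0 then (0, 0) else ((⨅ j, (stops (R j)).1) + 1, (⨅ j, (stops (R j)).1) + 1)
    else if n = 0 then ((⨆ i, (stops (L i)).2) - 1, (⨆ i, (stops (L i)).2) - 1)
    else if (⨅ j, (stops (R j)).1) + 1 ≤ (⨆ i, (stops (L i)).2) - 1 then
      ((⨆ i, (stops (L i)).2) - 1, (⨅ j, (stops (R j)).1) + 1)
    -- Testing the sign of Left's value suffices: when it is negative, `P`-freeness will force
    -- Right's value to be at most 0.
    else if 0 ≤ (⨆ i, (stops (L i)).2) - 1 then
      ((⨅ j, (stops (R j)).1) + 1, (⨅ j, (stops (R j)).1) + 1)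
    else ((⨆ i, (stops (L i)).2) - 1, (⨆ i, (stops (L i)).2) - 1)

/-- The Left stop. -/
noncomputable def leftStop (G : GameForm) : ℤ := (stops G).1

/-- The Right stop. -/
noncomputable def rightStop (G : GameForm) : ℤ := (stops G).2

theorem exists_iSup_rightStop {m : ℕ} (hm : m ≠ 0) (L : Fin m → GameForm) :
    ∃ i, (⨆ i, (stops (L i)).2) = rightStop (L i) ∧ ∀ k, rightStop (L k) ≤ rightStop (L i) := by
  have : Nonempty (Fin m) := ⟨⟨0, Nat.pos_of_ne_zero hm⟩⟩
  obtain ⟨i, hi⟩ := exists_eq_ciSup_of_finite (f := fun i => (stops (L i)).2)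
  exact ⟨i, hi.symm, fun k => (le_ciSup (Set.finite_range _).bddAbove k).trans_eq hi.symm⟩

theorem exists_iInf_leftStop {n : ℕ} (hn : n ≠ 0) (R : Fin n → GameForm) :
    ∃ j, (⨅ j, (stops (R j)).1) = leftStop (R j) ∧ ∀ k, leftStop (R j) ≤ leftStop (R k) := by
  have : Nonempty (Fin n) := ⟨⟨0, Nat.pos_of_ne_zero hn⟩⟩
  obtain ⟨i, hi⟩ := exists_eq_ciInf_of_finite (f := fun i => (stops (R i)).1)
  exact ⟨i, hi.symm, fun k => hi.trans_le (ciInf_le (Set.finite_range _).bddBelow k)⟩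

theorem stops_of_isLeftEnd_of_isRightEnd {G : GameForm} (hL : G.IsLeftEnd) (hR : G.IsRightEnd) :
    leftStop G = 0 ∧ rightStop G = 0 := by
  obtain ⟨m, n, L, R⟩ := G
  rw [mk_isLeftEnd] at hL
  rw [mk_isRightEnd] at hR
  simp [leftStop, rightStop, stops, hL, hR]

theorem stops_of_isLeftEnd {G : GameForm} (hL : G.IsLeftEnd) (hR : ¬ G.IsRightEnd) :
    ∃ Y, G.IsRightOption Y ∧ (∀ Z, G.IsRightOption Z → leftStop Y ≤ leftStop Z) ∧
      leftStop G = leftStop Y + 1 ∧ rightStop G = leftStop Y + 1 := by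
  obtain ⟨m, n, L, R⟩ := G
  rw [mk_isLeftEnd] at hL
  rw [mk_isRightEnd] at hR
  obtain ⟨j, hj, hmin⟩ := exists_iInf_leftStop hR R
  refine ⟨R j, ⟨j, rfl⟩, by rintro _ ⟨k, rfl⟩; exact hmin k, ?_⟩
  rw [leftStop.eq_1 (mk m n L R), rightStop.eq_1 (mk m n L R), stops, hj, if_pos hL, if_neg hR]
  exact ⟨rfl, rfl⟩

theorem stops_of_isRightEnd {G : GameForm} (hL : ¬ G.IsLeftEnd) (hR : G.IsRightEnd) :
    ∃ X, G.IsLeftOption X ∧ (∀ Z, G.IsLeftOption Z → rightStop Z ≤ rightStop X) ∧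
      leftStop G = rightStop X - 1 ∧ rightStop G = rightStop X - 1 := by
  obtain ⟨m, n, L, R⟩ := G
  rw [mk_isLeftEnd] at hL
  rw [mk_isRightEnd] at hR
  obtain ⟨i, hi, hmax⟩ := exists_iSup_rightStop hL L
  refine ⟨L i, ⟨i, rfl⟩, by rintro _ ⟨k, rfl⟩; exact hmax k, ?_⟩
  rw [leftStop.eq_1 (mk m n L R), rightStop.eq_1 (mk m n L R), stops, hi, if_neg hL, if_pos hR]
  exact ⟨rfl, rfl⟩

theorem stops_of_not_end {G : GameForm} (hL : ¬ G.IsLeftEnd) (hR : ¬ G.IsRightEnd) :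
    ∃ X Y, G.IsLeftOption X ∧ G.IsRightOption Y ∧
      (∀ Z, G.IsLeftOption Z → rightStop Z ≤ rightStop X) ∧
      (∀ Z, G.IsRightOption Z → leftStop Y ≤ leftStop Z) ∧
      ((leftStop Y + 1 ≤ rightStop X - 1 ∧
          leftStop G = rightStop X - 1 ∧ rightStop G = leftStop Y + 1) ∨
        (rightStop X - 1 < leftStop Y + 1 ∧ 0 ≤ rightStop X - 1 ∧
          leftStop G = leftStop Y + 1 ∧ rightStop G = leftStop Y + 1) ∨
        (rightStop X - 1 < leftStop Y + 1 ∧ rightStop X - 1 < 0 ∧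
          leftStop G = rightStop X - 1 ∧ rightStop G = rightStop X - 1)) := by
  obtain ⟨m, n, L, R⟩ := G
  rw [mk_isLeftEnd] at hL
  rw [mk_isRightEnd] at hR
  obtain ⟨i, hi, hmax⟩ := exists_iSup_rightStop hL L
  obtain ⟨j, hj, hmin⟩ := exists_iInf_leftStop hR R
  refine ⟨L i, R j, ⟨i, rfl⟩, ⟨j, rfl⟩, by rintro _ ⟨k, rfl⟩; exact hmax k,
    by rintro _ ⟨k, rfl⟩; exact hmin k, ?_⟩
  rw [leftStop.eq_1 (mk m n L R), rightStop.eq_1 (mk m n L R), stops, hi, hj, if_neg hL, if_neg hR]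
  split_ifs with h1 h2
  · exact Or.inl ⟨h1, rfl, rfl⟩
  · exact Or.inr (Or.inl ⟨not_le.1 h1, h2, rfl, rfl⟩)
  · exact Or.inr (Or.inr ⟨not_le.1 h1, not_le.1 h2, rfl, rfl⟩)

theorem rightStop_le_leftStop (G : GameForm) : rightStop G ≤ leftStop G := by
  by_cases hL : G.IsLeftEnd <;> by_cases hR : G.IsRightEnd
  · have := stops_of_isLeftEnd_of_isRightEnd hL hR
    omega
  · obtain ⟨_, -, -, h⟩ := stops_of_isLeftEnd hL hR
    omega
  · obtain ⟨_, -, -, h⟩ := stops_of_isRightEnd hL hR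
    omega
  · obtain ⟨_, _, -, -, -, -, h⟩ := stops_of_not_end hL hR
    omega

theorem leftStop_eq_rightStop_of_isLeftEnd {G : GameForm} (hL : G.IsLeftEnd) :
    leftStop G = rightStop G := by
  by_cases hR : G.IsRightEnd
  · have := stops_of_isLeftEnd_of_isRightEnd hL hR
    omega
  · obtain ⟨_, -, -, h⟩ := stops_of_isLeftEnd hL hR
    omega

theorem leftStop_eq_rightStop_of_isRightEnd {G : GameForm} (hR : G.IsRightEnd) :
    leftStop G = rightStop G := by
  by_cases hL : G.IsLeftEnd
  · have := stops_of_isLeftEnd_of_isRightEnd hL hR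
    omega
  · obtain ⟨_, -, -, h⟩ := stops_of_isRightEnd hL hR
    omega

/-- Whenever Right can move, each case of the definition keeps the Right stop at or below Right's
best value; no `P`-freeness is needed. -/
theorem IsRightOption.rightStop_le {G G' : GameForm} (h : G.IsRightOption G') :
    rightStop G ≤ leftStop G' + 1 := by
  have hR : ¬ G.IsRightEnd := fun hR => hR _ h
  by_cases hL : G.IsLeftEnd
  · obtain ⟨_, -, h1, h2⟩ := stops_of_isLeftEnd hL hR
    have := h1 _ h
    omega
  · obtain ⟨_, _, -, -, -, h1, h2⟩ := stops_of_not_end hL hR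
    have := h1 _ h
    omega

theorem IsLeftOption.le_leftStop {G G' : GameForm} (h : G.IsLeftOption G') :
    rightStop G' - 1 ≤ leftStop G := by
  have hL : ¬ G.IsLeftEnd := fun hL => hL _ h
  by_cases hR : G.IsRightEnd
  · obtain ⟨_, -, h1, h2⟩ := stops_of_isRightEnd hL hR
    have := h1 _ h
    omega
  · obtain ⟨_, _, -, -, h1, -, h2⟩ := stops_of_not_end hL hR
    have := h1 _ h
    omega

/-- The unit added by Right's move pays for the unit subtracted by Left's blocking answer. -/
theorem IsBlockedLeftEnd.rightStop_nonneg {G : GameForm} (hG : G.IsBlockedLeftEnd) :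
    0 ≤ rightStop G := by
  induction G using subposition_induction with
  | h G ih =>
    obtain ⟨hL, hG⟩ := isBlockedLeftEnd_iff.1 hG
    by_cases hR : G.IsRightEnd
    · exact (stops_of_isLeftEnd_of_isRightEnd hL hR).2.ge
    · obtain ⟨Y, hY, -, -, h⟩ := stops_of_isLeftEnd hL hR
      rcases hG Y hY with hb | ⟨Z, hZ, hb⟩
      · have h1 := ih Y (.single (Or.inr hY)) hb
        have h2 := rightStop_le_leftStop Y
        omega
      · have h1 := ih Z (.tail (.single (Or.inl hZ)) (Or.inr hY)) hb
        have h2 := hZ.le_leftStop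
        omega

theorem IsBlockedRightEnd.leftStop_nonpos {G : GameForm} (hG : G.IsBlockedRightEnd) :
    leftStop G ≤ 0 := by
  induction G using subposition_induction with
  | h G ih =>
    obtain ⟨hR, hG⟩ := isBlockedRightEnd_iff.1 hG
    by_cases hL : G.IsLeftEnd
    · exact (stops_of_isLeftEnd_of_isRightEnd hL hR).1.le
    · obtain ⟨Y, hY, -, h, -⟩ := stops_of_isRightEnd hL hR
      rcases hG Y hY with hb | ⟨Z, hZ, hb⟩
      · have h1 := ih Y (.single (Or.inl hY)) hb
        have h2 := rightStop_le_leftStop Y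
        omega
      · have h1 := ih Z (.tail (.single (Or.inr hZ)) (Or.inl hY)) hb
        have h2 := hZ.rightStop_le
        omega

-- Stops and outcomes of `P`-free blocking forms

theorem rightStop_nonneg_of_isLeftEnd {G : GameForm} (hG : G ∈ pFree blockingUniverse)
    (h : G.IsLeftEnd) : 0 ≤ rightStop G :=
  ((hG.1 G .refl).1 h).rightStop_nonneg

theorem leftStop_nonpos_of_isRightEnd {G : GameForm} (hG : G ∈ pFree blockingUniverse)
    (h : G.IsRightEnd) : leftStop G ≤ 0 :=
  ((hG.1 G .refl).2 h).leftStop_nonpos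

/-- Either the Left stop is attained by a Left move, or both stops agree and are nonnegative, and
Left has nothing to fear on her turn. -/
theorem leftStop_cases {G : GameForm} (hG : G ∈ pFree blockingUniverse) :
    (∃ X, G.IsLeftOption X ∧ leftStop G = rightStop X - 1) ∨
      (leftStop G = rightStop G ∧ 0 ≤ rightStop G ∧
        (G.IsLeftEnd ∨ ∃ X, G.IsLeftOption X ∧ 0 < rightStop X)) := by
  by_cases hL : G.IsLeftEnd
  · exact Or.inr ⟨leftStop_eq_rightStop_of_isLeftEnd hL, rightStop_nonneg_of_isLeftEnd hG hL,
      Or.inl hL⟩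
  by_cases hR : G.IsRightEnd
  · obtain ⟨X, hX, -, h, -⟩ := stops_of_isRightEnd hL hR
    exact Or.inl ⟨X, hX, h⟩
  · obtain ⟨X, Y, hX, hY, -, -, h | h | h⟩ := stops_of_not_end hL hR
    · exact Or.inl ⟨X, hX, h.2.1⟩
    · exact Or.inr ⟨by omega, by omega, Or.inr ⟨X, hX, by omega⟩⟩
    · exact Or.inl ⟨X, hX, h.2.2.1⟩

/-- The outcome of a `P`-free blocking form is determined by the signs of its stops. -/
theorem winsFirst_iff_stops {G : GameForm} (hG : G ∈ pFree blockingUniverse) :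
    (G.LeftWinsFirst ↔ 0 ≤ leftStop G) ∧ (G.RightWinsFirst ↔ rightStop G ≤ 0) := by
  induction G using option_induction with
  | h G ihL ihR =>
    have hl : (∃ X, G.IsLeftOption X ∧ ¬ X.RightWinsFirst) ↔
        ∃ X, G.IsLeftOption X ∧ 0 < rightStop X :=
      exists_congr fun X => and_congr_right fun hX => by
        rw [(ihL X hX (hX.mem_pFree hG)).2, not_le]
    have hr : (∃ X, G.IsRightOption X ∧ ¬ X.LeftWinsFirst) ↔
        ∃ X, G.IsRightOption X ∧ leftStop X < 0 :=
      exists_congr fun X => and_congr_right fun hX => by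
        rw [(ihR X hX (hX.mem_pFree hG)).1, not_le]
    have hP := outcome_ne_P.1 (hG.2 G .refl)
    rw [leftWinsFirst_iff, rightWinsFirst_iff, hl, hr] at hP ⊢
    have hle := rightStop_le_leftStop G
    refine ⟨⟨?_, fun h => ?_⟩, ⟨?_, fun h => ?_⟩⟩
    · rintro (h | ⟨X, hX, h⟩)
      · exact (rightStop_nonneg_of_isLeftEnd hG h).trans hle
      · have := hX.le_leftStop
        omega
    · rcases leftStop_cases hG with ⟨X, hX, h'⟩ | ⟨-, -, h'⟩
      · exact Or.inr ⟨X, hX, by omega⟩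
      · exact h'
    · rintro (h | ⟨X, hX, h⟩)
      · exact hle.trans (leftStop_nonpos_of_isRightEnd hG h)
      · have := hX.rightStop_le
        omega
    · by_cases hR : G.IsRightEnd
      · exact Or.inl hR
      refine Or.inr ?_
      by_cases hL : G.IsLeftEnd
      · obtain ⟨Y, hY, -, h'⟩ := stops_of_isLeftEnd hL hR
        exact ⟨Y, hY, by omega⟩
      · obtain ⟨X, Y, hX, hY, hmax, -, h' | h' | h'⟩ := stops_of_not_end hL hR
        · exact ⟨Y, hY, by omega⟩
        · exact ⟨Y, hY, by omega⟩
        -- Left's best value is negative, so she has no winning move; since the outcome is not `P`,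
        -- Right has one.
        · rcases hP with (hP | ⟨Z, hZ, hP⟩) | hP | hP
          · exact absurd hP hL
          · have := hmax Z hZ
            omega
          · exact absurd hP hR
          · exact hP

/-- Either the Right stop is attained by a Right move, or both stops agree and are nonpositive, and
Right has nothing to fear on his turn. -/
theorem rightStop_cases {G : GameForm} (hG : G ∈ pFree blockingUniverse) :
    (∃ X, G.IsRightOption X ∧ rightStop G = leftStop X + 1) ∨
      (leftStop G = rightStop G ∧ leftStop G ≤ 0 ∧
        (G.IsRightEnd ∨ ∃ X, G.IsRightOption X ∧ leftStop X < 0)) := by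
  by_cases hR : G.IsRightEnd
  · exact Or.inr ⟨leftStop_eq_rightStop_of_isRightEnd hR, leftStop_nonpos_of_isRightEnd hG hR,
      Or.inl hR⟩
  by_cases hL : G.IsLeftEnd
  · obtain ⟨X, hX, -, -, h⟩ := stops_of_isLeftEnd hL hR
    exact Or.inl ⟨X, hX, h⟩
  · obtain ⟨X, Y, hX, hY, -, -, h | h | h⟩ := stops_of_not_end hL hR
    · exact Or.inl ⟨Y, hY, h.2.2⟩
    · exact Or.inl ⟨Y, hY, h.2.2.2⟩
    · refine Or.inr ⟨by omega, by omega, Or.inr ?_⟩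
      -- Both stops are Left's negative value and say nothing about Right's moves, so his good move
      -- is read off from the outcome.
      have hw := (winsFirst_iff_stops hG).2.2 (by omega)
      obtain ⟨Z, hZ, hw⟩ := (rightWinsFirst_iff.1 hw).resolve_left hR
      rw [(winsFirst_iff_stops (hZ.mem_pFree hG)).1, not_le] at hw
      exact ⟨Z, hZ, hw⟩

/-! ### Sums of `P`-free blocking forms -/

/-- The three claims are proved together: a Right move lowers the relevant sum of stops by at most
one, and Left recovers that unit by a move attaining a Left stop. A strict bound with Right to move
thus alternates with a weak one with Left to move. -/
theorem left_wins_add {G H : GameForm} (hG : G ∈ pFree blockingUniverse)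
    (hH : H ∈ pFree blockingUniverse) :
    (0 < rightStop G + rightStop H → ¬ (G + H).RightWinsFirst) ∧
    (0 ≤ leftStop G + rightStop H → (G + H).LeftWinsFirst) ∧
    (0 ≤ rightStop G + leftStop H → (G + H).LeftWinsFirst) := by
  induction G using option_induction generalizing H with
  | h G ihGL ihGR =>
  induction H using option_induction with
  | h H ihHL ihHR =>
    have hlG := rightStop_le_leftStop G
    have hlH := rightStop_le_leftStop H
    have moveG : ∀ X, G.IsLeftOption X → 0 < rightStop X + rightStop H →
        (G + H).LeftWinsFirst := fun X hX h =>
      leftWinsFirst_iff.2 (Or.inr ⟨X + H, isLeftOption_add.2 (Or.inl ⟨X, hX, rfl⟩),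
        (ihGL X hX (hX.mem_pFree hG) hH).1 h⟩)
    have moveH : ∀ X, H.IsLeftOption X → 0 < rightStop G + rightStop X →
        (G + H).LeftWinsFirst := fun X hX h =>
      leftWinsFirst_iff.2 (Or.inr ⟨G + X, isLeftOption_add.2 (Or.inr ⟨X, hX, rfl⟩),
        (ihHL X hX (hX.mem_pFree hH)).1 h⟩)
    refine ⟨fun h hw => ?_, fun h => ?_, fun h => ?_⟩
    · rcases rightWinsFirst_iff.1 hw with he | ⟨K, hK, hw⟩
      · have h1 := leftStop_nonpos_of_isRightEnd hG (isRightEnd_add.1 he).1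
        have h2 := leftStop_nonpos_of_isRightEnd hH (isRightEnd_add.1 he).2
        omega
      · rcases isRightOption_add.1 hK with ⟨X, hX, rfl⟩ | ⟨X, hX, rfl⟩
        · have := hX.rightStop_le
          exact hw ((ihGR X hX (hX.mem_pFree hG) hH).2.1 (by omega))
        · have := hX.rightStop_le
          exact hw ((ihHR X hX (hX.mem_pFree hH)).2.2 (by omega))
    all_goals
      rcases leftStop_cases hG with ⟨X, hX, hGX⟩ | ⟨hG1, hG2, hG3⟩ <;>
      rcases leftStop_cases hH with ⟨Y, hY, hHY⟩ | ⟨hH1, hH2, hH3⟩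
      all_goals first
        | exact moveG X hX (by omega)
        | exact moveH Y hY (by omega)
        | skip
      -- Neither Left stop is attained here, so both Right stops are nonnegative. A move to a
      -- positive Right stop in either component wins; if neither has one, the sum is a Left end.
      rcases hG3 with hG3 | ⟨X, hX, hG3⟩
      · rcases hH3 with hH3 | ⟨X, hX, hH3⟩
        · exact leftWinsFirst_iff.2 (Or.inl (isLeftEnd_add.2 ⟨hG3, hH3⟩))
        · exact moveH X hX (by omega)
      · exact moveG X hX (by omega)

theorem right_wins_add {G H : GameForm} (hG : G ∈ pFree blockingUniverse)
    (hH : H ∈ pFree blockingUniverse) :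
    (leftStop G + leftStop H < 0 → ¬ (G + H).LeftWinsFirst) ∧
    (rightStop G + leftStop H ≤ 0 → (G + H).RightWinsFirst) ∧
    (leftStop G + rightStop H ≤ 0 → (G + H).RightWinsFirst) := by
  induction G using option_induction generalizing H with
  | h G ihGL ihGR =>
  induction H using option_induction with
  | h H ihHL ihHR =>
    have hlG := rightStop_le_leftStop G
    have hlH := rightStop_le_leftStop H
    have moveG : ∀ X, G.IsRightOption X → leftStop X + leftStop H < 0 →
        (G + H).RightWinsFirst := fun X hX h =>
      rightWinsFirst_iff.2 (Or.inr ⟨X + H, isRightOption_add.2 (Or.inl ⟨X, hX, rfl⟩),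
        (ihGR X hX (hX.mem_pFree hG) hH).1 h⟩)
    have moveH : ∀ X, H.IsRightOption X → leftStop G + leftStop X < 0 →
        (G + H).RightWinsFirst := fun X hX h =>
      rightWinsFirst_iff.2 (Or.inr ⟨G + X, isRightOption_add.2 (Or.inr ⟨X, hX, rfl⟩),
        (ihHR X hX (hX.mem_pFree hH)).1 h⟩)
    refine ⟨fun h hw => ?_, fun h => ?_, fun h => ?_⟩
    · rcases leftWinsFirst_iff.1 hw with he | ⟨K, hK, hw⟩
      · have h1 := rightStop_nonneg_of_isLeftEnd hG (isLeftEnd_add.1 he).1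
        have h2 := rightStop_nonneg_of_isLeftEnd hH (isLeftEnd_add.1 he).2
        omega
      · rcases isLeftOption_add.1 hK with ⟨X, hX, rfl⟩ | ⟨X, hX, rfl⟩
        · have := hX.le_leftStop
          exact hw ((ihGL X hX (hX.mem_pFree hG) hH).2.1 (by omega))
        · have := hX.le_leftStop
          exact hw ((ihHL X hX (hX.mem_pFree hH)).2.2 (by omega))
    all_goals
      rcases rightStop_cases hG with ⟨X, hX, hGX⟩ | ⟨hG1, hG2, hG3⟩ <;>
      rcases rightStop_cases hH with ⟨Y, hY, hHY⟩ | ⟨hH1, hH2, hH3⟩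
      all_goals first
        | exact moveG X hX (by omega)
        | exact moveH Y hY (by omega)
        | skip
      rcases hG3 with hG3 | ⟨X, hX, hG3⟩
      · rcases hH3 with hH3 | ⟨X, hX, hH3⟩
        · exact rightWinsFirst_iff.2 (Or.inl (isRightEnd_add.2 ⟨hG3, hH3⟩))
        · exact moveH X hX (by omega)
      · exact moveG X hX (by omega)

theorem add_mem_pFree {G H : GameForm} (hG : G ∈ pFree blockingUniverse)
    (hH : H ∈ pFree blockingUniverse) : G + H ∈ pFree blockingUniverse := by
  refine ⟨add_mem_blockingUniverse G hG.1 H hH.1, fun K hK => ?_⟩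
  obtain ⟨G', H', hG', hH', rfl⟩ := hK.exists_of_add
  replace hG := mem_pFree_of_isSubposition hG hG'
  replace hH := mem_pFree_of_isSubposition hH hH'
  rw [outcome_ne_P]
  -- The same integer decides for both players; at 0 both win moving first.
  rcases le_total 0 (leftStop G' + rightStop H') with h | h
  · exact Or.inl ((left_wins_add hG hH).2.1 h)
  · exact Or.inr ((right_wins_add hG hH).2.2 h)

end GameForm

theorem mainTheorem2 :
    (∀ G ∈ GameForm.pFree GameForm.blockingUniverse,
      ∀ H ∈ GameForm.pFree GameForm.blockingUniverse,
        G + H ∈ GameForm.pFree GameForm.blockingUniverse) ∧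
    (∀ G ∈ GameForm.pFreeMod GameForm.blockingUniverse GameForm.blockingUniverse,
      ∀ H ∈ GameForm.pFreeMod GameForm.blockingUniverse GameForm.blockingUniverse,
        G + H ∈ GameForm.pFreeMod GameForm.blockingUniverse GameForm.blockingUniverse) := by
  refine ⟨fun G hG H hH => GameForm.add_mem_pFree hG hH, ?_⟩
  rintro G ⟨hG, G', hG', hGP, hGe⟩ H ⟨hH, H', hH', hHP, hHe⟩
  have hPF := GameForm.add_mem_pFree ⟨hG', hGP⟩ ⟨hH', hHP⟩
  exact ⟨GameForm.add_mem_blockingUniverse G hG H hH, G' + H', hPF.1, hPF.2,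
    hGe.add GameForm.add_mem_blockingUniverse hHe hH hG'⟩
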